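/- Throughout, $\log$ is the logarithm to base $2$; a proper edge-coloring is one in which distinct edges sharing a vertex receive distinct colors; $\delta(G)$ is the minimum degree of $G$, $d_G(v)$ is the degree of $v$ in $G$, and $e_H(A,B)$ is the number of edges of $H$ with one endpoint in $A$ and the other in $B$. For every sufficiently small $\varepsilon>0$ there exists a constant $C>0$, depending only on $\varepsilon$, such that the following holds. Let $G$ be a properly edge-colored graph on $n$ vertices with $\delta(G)\ge(1-\delta)n$ for some real $\delta=\delta(n)$, and let $p=p(n)\in(0,1]$. Let $H$ be the random spanning subgraph of $G$ obtained by selecting every color independently with probability $p$ and keeping exactly the edges whose color is selected. Then, with probability tending to $1$ as $n\to\infty$, uniformly over all choices of $G$, its coloring, $\delta$ and $p$, both of the following hold. (a) If $(1-\delta)n\ge C\,\frac{\log n}{p}$, then every vertex $v$ satisfies $(1-\varepsilon)\,p\,d_G(v)\le d_H(v)\le(1+\varepsilon)\,p\,d_G(v)$. (b) For every pair of disjoint vertex sets $A$ and $B$ with $|A|\ge C\,\frac{\log n}{p}$ and $|B|\ge\max\left\{C\left(\frac{\log n}{p}\right)^2,\;C\delta n\right\}$, we have $e_H(A,B)\ge(1-\varepsilon)\,p\,|A||B|$.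 -/

import Mathlib

namespace SimpleGraph.EdgeLabeling

/-- A proper edge-coloring: distinct edges that share a vertex get distinct colors. -/
def IsProper {V κ : Type*} {G : SimpleGraph V} (c : G.EdgeLabeling κ) : Prop :=
  ∀ e f : G.edgeSet, e ≠ f → (∃ v : V, v ∈ (e : Sym2 V) ∧ v ∈ (f : Sym2 V)) → c e ≠ c f

/-- The spanning subgraph of `G` consisting of the edges whose color lies in `S`. -/
def keep {V κ : Type*} {G : SimpleGraph V} (c : G.EdgeLabeling κ) (S : Set κ) :
    SimpleGraph V where
  Adj x y := ∃ h : G.Adj x y, c ⟨s(x, y), h⟩ ∈ S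
  symm := ⟨by
    rintro x y ⟨h, hc⟩
    refine ⟨h.symm, ?_⟩
    have e : (⟨s(y, x), h.symm⟩ : G.edgeSet) = ⟨s(x, y), h⟩ := Subtype.ext Sym2.eq_swap
    exact e ▸ hc⟩
  loopless := ⟨fun x hx => G.loopless.irrefl x hx.1⟩

noncomputable instance {V κ : Type*} {G : SimpleGraph V} (c : G.EdgeLabeling κ) (S : Set κ) :
    DecidableRel (c.keep S).Adj := Classical.decRel _

end SimpleGraph.EdgeLabeling

/-! Properness makes the colors at a vertex distinct, so degrees in `H` count independent selected
colors, and (a) is a Chernoff bound with a union bound over vertices.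

For (b), a union bound over all pairs `A`, `B` is too expensive. Instead take `l` of order `log n /
p` and consider all `n ^ (2 * l)` pairs of index maps `f`, `g : Fin l → V`. By Chernoff each `l × l`
sample has almost the expected number of selected colors except with probability `exp (-c * p * l ^
2)`, which beats the number of samples (`measureReal_exists_sample_le`).

The rest is deterministic. Average over maps into `A` and into `B`: the mean number of selected
cells is `l ^ 2` times the density of `H` between `A` and `B`. Distinct colors fall short of `l ^ 2`
only through non-edges, of density at most `δ * n / |B|`, and color collisions, on average at most
`l ^ 2 * (l ^ 2 / |B| + l / |A|)` (`sum_sum_card_collisions_le`). The sizes assumed for `A` and `B`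
make all these losses small. -/

section ColorSelection

open MeasureTheory ProbabilityTheory

open Classical in
lemma sum_indicator_eq_card_filter {κ Ω : Type*} {sel : κ → Set Ω} (K : Finset κ) (ω : Ω) :
    (∑ k ∈ K, (sel k).indicator fun _ => (1 : ℝ)) ω = (K.filter fun k => ω ∈ sel k).card := by
  simp [Finset.sum_apply, Set.indicator_apply]

/-! ### Chernoff bounds for the number of selected colors -/

section Chernoff

variable {κ Ω : Type*} [MeasurableSpace Ω] {μ : Measure Ω} [IsProbabilityMeasure μ]
  {sel : κ → Set Ω} {p : ℝ}

lemma mgf_indicator_one {s : Set Ω} (hs : MeasurableSet s) (t : ℝ) :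
    mgf (s.indicator fun _ => (1 : ℝ)) μ t = 1 + μ.real s * (Real.exp t - 1) := by
  have h : (fun ω => Real.exp (t * s.indicator (fun _ => (1 : ℝ)) ω)) =
      fun ω => 1 + s.indicator (fun _ => Real.exp t - 1) ω := by
    funext ω
    by_cases hω : ω ∈ s <;> simp [hω]
  rw [mgf, h, integral_add (integrable_const _) ((integrable_const _).indicator hs),
    integral_indicator_const _ hs]
  simp

/-- Independence factors the moment generating function, and `exp t - 1 ≤ t + t ^ 2` for `|t| ≤ 1`
bounds each factor. -/
lemma mgf_sum_indicator_le (hmeas : ∀ k, MeasurableSet (sel k)) (hind : iIndepSet sel μ)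
    (hp : 0 ≤ p) (hsel : ∀ k, μ (sel k) = ENNReal.ofReal p) (K : Finset κ) {t : ℝ}
    (ht : |t| ≤ 1) :
    mgf (∑ k ∈ K, (sel k).indicator fun _ => (1 : ℝ)) μ t ≤
      Real.exp (p * K.card * (t + t ^ 2)) := by
  rw [hind.iIndepFun_indicator.mgf_sum
    (fun k => measurable_const.indicator (hmeas k)) K]
  have h1 : ∀ k ∈ K, mgf ((sel k).indicator fun _ => (1 : ℝ)) μ t ≤
      Real.exp (p * (t + t ^ 2)) := by
    intro k _
    rw [mgf_indicator_one (hmeas k), measureReal_def, hsel k, ENNReal.toReal_ofReal hp]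
    have h2 := (abs_le.1 (Real.abs_exp_sub_one_sub_id_le ht)).2
    have h3 := Real.add_one_le_exp (p * (t + t ^ 2))
    nlinarith
  calc _ ≤ ∏ _k ∈ K, Real.exp (p * (t + t ^ 2)) :=
        Finset.prod_le_prod (fun k _ => mgf_nonneg) h1
    _ = _ := by
        rw [Finset.prod_const, ← Real.exp_nat_mul]
        ring_nf

lemma integrable_exp_sum_indicator (hmeas : ∀ k, MeasurableSet (sel k)) (K : Finset κ) (t : ℝ) :
    Integrable (fun ω => Real.exp (t * (∑ k ∈ K, (sel k).indicator fun _ => (1 : ℝ)) ω)) μ := by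
  have hm : Measurable (∑ k ∈ K, (sel k).indicator fun _ => (1 : ℝ))  := by
    rw [Finset.sum_fn]
    exact Finset.measurable_sum _ fun k _ => measurable_const.indicator (hmeas k)
  refine Integrable.of_bound (C := Real.exp (|t| * K.card))
    (by fun_prop) (Filter.Eventually.of_forall fun ω => ?_)
  classical
  rw [Real.norm_eq_abs, Real.abs_exp, Real.exp_le_exp, sum_indicator_eq_card_filter]
  gcongr
  · exact le_abs_self t
  · exact Finset.filter_subset _ _

-- The deviation is measured against `M`, not `K.card`, so samples with few distinct colors obey the
-- same bound. The choice `t = -(ε / 2)` gives exponent `p * K.card * ε ^ 2 / 4 - p * M * ε ^ 2 /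
-- 2`.
open Classical in
lemma measureReal_card_selected_le (hmeas : ∀ k, MeasurableSet (sel k)) (hind : iIndepSet sel μ)
    (hp : 0 ≤ p) (hsel : ∀ k, μ (sel k) = ENNReal.ofReal p) (K : Finset κ) {M ε : ℝ}
    (hKM : K.card ≤ M) (hε : 0 ≤ ε) (hε2 : ε ≤ 2) :
    μ.real {ω | ((K.filter fun k => ω ∈ sel k).card : ℝ) ≤ p * K.card - ε * (p * M)} ≤
      Real.exp (-(ε ^ 2 / 4) * (p * M)) := by
  have h := measure_le_le_exp_mul_mgf (μ := μ) (p * K.card - ε * (p * M)) (t := -(ε / 2))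
    (by linarith) (integrable_exp_sum_indicator hmeas K _)
  simp only [sum_indicator_eq_card_filter] at h
  refine h.trans ((mul_le_mul_of_nonneg_left (mgf_sum_indicator_le hmeas hind hp hsel K
    (by rw [abs_neg, abs_of_nonneg] <;> linarith)) (Real.exp_pos _).le).trans ?_)
  rw [← Real.exp_add, Real.exp_le_exp]
  nlinarith [mul_le_mul_of_nonneg_left hKM (mul_nonneg hp (sq_nonneg ε))]

open Classical in
lemma measureReal_le_card_selected (hmeas : ∀ k, MeasurableSet (sel k)) (hind : iIndepSet sel μ)
    (hp : 0 ≤ p) (hsel : ∀ k, μ (sel k) = ENNReal.ofReal p) (K : Finset κ) {M ε : ℝ}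
    (hKM : K.card ≤ M) (hε : 0 ≤ ε) (hε2 : ε ≤ 2) :
    μ.real {ω | p * K.card + ε * (p * M) ≤ ((K.filter fun k => ω ∈ sel k).card : ℝ)} ≤
      Real.exp (-(ε ^ 2 / 4) * (p * M)) := by
  have h := measure_ge_le_exp_mul_mgf (μ := μ) (p * K.card + ε * (p * M)) (t := ε / 2)
    (by linarith) (integrable_exp_sum_indicator hmeas K _)
  simp only [sum_indicator_eq_card_filter] at h
  refine h.trans ((mul_le_mul_of_nonneg_left (mgf_sum_indicator_le hmeas hind hp hsel K
    (by rw [abs_of_nonneg] <;> linarith)) (Real.exp_pos _).le).trans ?_)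
  rw [← Real.exp_add, Real.exp_le_exp]
  nlinarith [mul_le_mul_of_nonneg_left hKM (mul_nonneg hp (sq_nonneg ε))]

end Chernoff

end ColorSelection

/-! ### The coloring as a partial array indexed by pairs of vertices -/

namespace SimpleGraph.EdgeLabeling

variable {V κ : Type*} {G : SimpleGraph V}

open Classical in
/-- The color of the pair `x`, `y`, or `none` if the two vertices are not adjacent. -/
noncomputable def color? (c : G.EdgeLabeling κ) (x y : V) : Option κ :=
  if h : G.Adj x y then some (c ⟨s(x, y), h⟩) else none

lemma color?_eq_none {c : G.EdgeLabeling κ} {x y : V} : c.color? x y = none ↔ ¬ G.Adj x y := by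
  simp [color?]

lemma color?_eq_some {c : G.EdgeLabeling κ} {x y : V} {k : κ} :
    c.color? x y = some k ↔ ∃ h : G.Adj x y, c ⟨s(x, y), h⟩ = k := by
  unfold color?
  split_ifs with h <;> simp [h]

lemma keep_adj_iff {c : G.EdgeLabeling κ} {S : Set κ} {x y : V} :
    (c.keep S).Adj x y ↔ ∃ k ∈ S, c.color? x y = some k := by
  simp only [color?_eq_some]
  constructor
  · rintro ⟨h, hS⟩
    exact ⟨_, hS, h, rfl⟩
  · rintro ⟨_, hS, h, rfl⟩
    exact ⟨h, hS⟩

lemma color?_comm (c : G.EdgeLabeling κ) (x y : V) : c.color? x y = c.color? y x := by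
  ext k
  simp only [color?_eq_some, G.adj_comm x y, Sym2.eq_swap (a := x)]

lemma IsProper.color?_right_inj {c : G.EdgeLabeling κ} (hc : c.IsProper) {x y z : V} {k : κ}
    (hy : c.color? x y = some k) (hz : c.color? x z = some k) : y = z := by
  obtain ⟨h, rfl⟩ := color?_eq_some.1 hy
  obtain ⟨h', hk⟩ := color?_eq_some.1 hz
  by_contra hne
  refine hc ⟨s(x, z), h'⟩ ⟨s(x, y), h⟩ ?_ ⟨x, by simp⟩ hk
  intro he
  have := congrArg Subtype.val he
  simp only [Sym2.congr_right] at this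
  exact hne this.symm

lemma IsProper.color?_left_inj {c : G.EdgeLabeling κ} (hc : c.IsProper) {x y z : V} {k : κ}
    (hy : c.color? y x = some k) (hz : c.color? z x = some k) : y = z :=
  hc.color?_right_inj (x := x) (by rwa [color?_comm]) (by rwa [color?_comm])

end SimpleGraph.EdgeLabeling

/-! ### Counting distinct values -/

section ValueSet

variable {ι κ : Type*} [Fintype ι]

open Classical in
/-- The set of proper values of an option-valued function on a finite type. -/
noncomputable def valueSet (R : ι → Option κ) : Finset κ :=
  (Finset.univ.image R).eraseNone

lemma mem_valueSet {R : ι → Option κ} {k : κ} : k ∈ valueSet R ↔ ∃ i, R i = some k := by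
  simp [valueSet]

open Classical in
lemma image_filter_eq_map_valueSet (R : ι → Option κ) (S : Set κ) :
    (Finset.univ.filter fun i => ∃ k ∈ S, R i = some k).image R =
      ((valueSet R).filter (· ∈ S)).map Function.Embedding.some := by
  ext o
  simp only [Finset.mem_image, Finset.mem_filter, Finset.mem_univ, true_and, Finset.mem_map,
    mem_valueSet, Function.Embedding.some_apply]
  constructor
  · rintro ⟨i, ⟨k, hk, hi⟩, rfl⟩
    exact ⟨k, ⟨⟨i, hi⟩, hk⟩, hi.symm⟩
  · rintro ⟨k, ⟨⟨i, hi⟩, hk⟩, rfl⟩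
    exact ⟨i, ⟨k, hk, hi⟩, hi⟩

open Classical in
lemma card_valueSet_filter_le (R : ι → Option κ) (S : Set κ) :
    ((valueSet R).filter (· ∈ S)).card ≤
      (Finset.univ.filter fun i => ∃ k ∈ S, R i = some k).card := by
  rw [← Finset.card_map Function.Embedding.some, ← image_filter_eq_map_valueSet]
  exact Finset.card_image_le

open Classical in
lemma card_valueSet_filter_eq {R : ι → Option κ}
    (hR : ∀ i j k, R i = some k → R j = some k → i = j) (S : Set κ) :
    ((valueSet R).filter (· ∈ S)).card =
      (Finset.univ.filter fun i => ∃ k ∈ S, R i = some k).card := by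
  rw [← Finset.card_map Function.Embedding.some, ← image_filter_eq_map_valueSet]
  refine Finset.card_image_of_injOn fun i hi j _ hij => ?_
  simp only [Finset.coe_filter, Finset.mem_univ, true_and, Set.mem_ofPred_eq] at hi
  obtain ⟨k, _, hk⟩ := hi
  exact hR i j k hk (hij ▸ hk)

open Classical in
/-- A family of option values misses at most as many values as there are indices without a value
and ordered pairs of distinct indices with equal values. -/
lemma card_le_card_valueSet_add (R : ι → Option κ) :
    Fintype.card ι ≤ (valueSet R).card + (Finset.univ.filter fun i => R i = none).card +
      (Finset.univ.filter fun q : ι × ι => q.1 ≠ q.2 ∧ R q.1 = R q.2 ∧ R q.1 ≠ none).card := by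
  rcases isEmpty_or_nonempty ι with _ | _
  · simp
  choose! r hr using fun (k : κ) (hk : k ∈ valueSet R) => mem_valueSet.1 hk
  set N := Finset.univ.filter fun i => R i = none
  set Q := Finset.univ.filter fun q : ι × ι => q.1 ≠ q.2 ∧ R q.1 = R q.2 ∧ R q.1 ≠ none
  -- An index without a value lies in `N`; any other is the representative `r k` of its value or
  -- collides with it.
  have hsub : (Finset.univ : Finset ι) ⊆ (valueSet R).image r ∪ N ∪ Q.image Prod.fst := by
    intro i _
    rcases hi : R i with _ | k
    · simp [N, hi]
    · have hk : k ∈ valueSet R := mem_valueSet.2 ⟨i, hi⟩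
      by_cases h : r k = i
      · exact Finset.mem_union_left _ (Finset.mem_union_left _ (Finset.mem_image.2 ⟨k, hk, h⟩))
      · refine Finset.mem_union_right _ (Finset.mem_image.2 ⟨(i, r k), ?_, rfl⟩)
        simp [Q, hi, hr k hk, Ne.symm h]
  calc Fintype.card ι ≤ _ := Finset.card_le_card hsub
    _ ≤ _ := (Finset.card_union_le _ _).trans (add_le_add ((Finset.card_union_le _ _).trans
        (add_le_add Finset.card_image_le le_rfl)) Finset.card_image_le)

end ValueSet

/-! ### Averaging over index maps -/

section Averaging

variable {ι α : Type*} [Fintype ι] [DecidableEq ι] [Fintype α]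

/-- Exchanging the coordinate `f i` with an independent point of `α` is an involution, so `f i` is
uniform. -/
lemma sum_eval_mul_card (i : ι) (F : α → ℝ) :
    (∑ f : ι → α, F (f i)) * Fintype.card α = Fintype.card (ι → α) * ∑ x, F x := by
  have h : ∑ q : (ι → α) × α, F (q.1 i) = ∑ q : (ι → α) × α, F q.2 := by
    refine Fintype.sum_equiv (Function.Involutive.toPerm
      (fun q : (ι → α) × α => (Function.update q.1 i q.2, q.1 i)) ?_) _ _ fun q => rfl
    intro q
    simp
  rw [Fintype.sum_prod_type, Fintype.sum_prod_type] at h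
  simpa [← Finset.sum_mul, ← Finset.mul_sum, mul_comm] using h

/-- If coordinate `j` is determined by the others on `S`, overwriting it by arbitrary values is
injective on `S × α`. -/
lemma card_mul_card_le_of_eq_of_eq_off (j : ι) (S : Finset (ι → α))
    (hS : ∀ g ∈ S, ∀ g' ∈ S, (∀ i ≠ j, g i = g' i) → g = g') :
    S.card * Fintype.card α ≤ Fintype.card (ι → α) := by
  classical
  rw [← Finset.card_univ (α := α), ← Finset.card_product, ← Finset.card_univ]
  refine Finset.card_le_card_of_injOn (fun q => Function.update q.1 j q.2) (by simp) ?_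
  rintro ⟨g, b⟩ hg ⟨g', b'⟩ hg' h
  simp only [Finset.coe_product, Set.mem_prod, Finset.mem_coe] at hg hg' h
  have hb : b = b' := by simpa using congrFun h j
  have : g = g' := hS g hg.1 g' hg'.1 fun i hi => by simpa [hi] using congrFun h i
  rw [this, hb]

end Averaging

section RandomSampling

variable {ι α β κ : Type*} [Fintype ι] [Fintype α] [Fintype β]

lemma sum_sum_eval_mul_card [DecidableEq ι] (i j : ι) (F : α → β → ℝ) :
    (∑ f : ι → α, ∑ g : ι → β, F (f i) (g j)) * (Fintype.card α * Fintype.card β) =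
      Fintype.card (ι → α) * Fintype.card (ι → β) * ∑ x, ∑ y, F x y := by
  have h1 : ∀ f : ι → α, (∑ g : ι → β, F (f i) (g j)) * Fintype.card β =
      Fintype.card (ι → β) * ∑ y, F (f i) y := fun f => sum_eval_mul_card j _
  have h2 := sum_eval_mul_card i fun x => ∑ y, F x y
  calc _ = (∑ f : ι → α, (∑ g : ι → β, F (f i) (g j)) * Fintype.card β) * Fintype.card α := by
        rw [← Finset.sum_mul]
        ring
    _ = _ := by
        simp only [h1]
        rw [← Finset.mul_sum, mul_assoc, h2]
        ring

open Classical in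
/-- Averaging, over random index maps `f` and `g`, the number of index pairs at which a predicate
holds gives its density. -/
lemma sum_sum_card_filter_mul_card (P : α → β → Prop) :
    (∑ f : ι → α, ∑ g : ι → β,
        ((Finset.univ.filter fun q : ι × ι => P (f q.1) (g q.2)).card : ℝ)) *
        (Fintype.card α * Fintype.card β) =
      Fintype.card (ι → α) * Fintype.card (ι → β) * (Fintype.card ι ^ 2 *
        (Finset.univ.filter fun z : α × β => P z.1 z.2).card) := by
  have h1 : ∀ (f : ι → α) (g : ι → β),
      ((Finset.univ.filter fun q : ι × ι => P (f q.1) (g q.2)).card : ℝ) =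
        ∑ q : ι × ι, if P (f q.1) (g q.2) then (1 : ℝ) else 0 := by
    intro f g
    simp
  have h2 : ((Finset.univ.filter fun z : α × β => P z.1 z.2).card : ℝ) =
      ∑ x, ∑ y, if P x y then (1 : ℝ) else 0 := by
    rw [← Fintype.sum_prod_type' (f := fun x y => if P x y then (1 : ℝ) else 0)]
    simp
  simp only [h1, h2]
  have h3 : ∑ f : ι → α, ∑ g : ι → β, ∑ q : ι × ι, (if P (f q.1) (g q.2) then (1 : ℝ) else 0) =
      ∑ q : ι × ι, ∑ f : ι → α, ∑ g : ι → β, (if P (f q.1) (g q.2) then (1 : ℝ) else 0) := by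
    exact (Finset.sum_congr rfl fun f _ => Finset.sum_comm).trans Finset.sum_comm
  rw [h3, Finset.sum_mul]
  simp only [fun q : ι × ι => sum_sum_eval_mul_card (α := α) (β := β) q.1 q.2
    fun x y => if P x y then (1 : ℝ) else 0]
  simp
  ring

-- For two cells in different sampled columns, the color of the first and all other choices
-- determine the second column: probability at most `1 / |β|`. In the same sampled column, the
-- second row is determined instead: at most `1 / |α|`, but only `l ^ 3` of the `l ^ 4` pairs of
-- cells are of this kind, where `l = |ι|`. Hence the unequal size demands on `A` and `B`.
open Classical in
lemma sum_sum_card_collisions_le [Nonempty α] [Nonempty β] (R : α → β → Option κ)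
    (hr : ∀ x y z k, R x y = some k → R x z = some k → y = z)
    (hc : ∀ x y z k, R y x = some k → R z x = some k → y = z) :
    ∑ f : ι → α, ∑ g : ι → β, ((Finset.univ.filter fun q : (ι × ι) × (ι × ι) => q.1 ≠ q.2 ∧
        R (f q.1.1) (g q.1.2) = R (f q.2.1) (g q.2.2) ∧ R (f q.1.1) (g q.1.2) ≠ none).card : ℝ) ≤
      Fintype.card (ι → α) * Fintype.card (ι → β) * (Fintype.card ι ^ 2 *
        ((Fintype.card ι : ℝ) ^ 2 / Fintype.card β + (Fintype.card ι : ℝ) / Fintype.card α)) := by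
  set a : ℝ := (Fintype.card α : ℝ)
  set b : ℝ := (Fintype.card β : ℝ)
  have ha : 0 < a := by simp [a, Fintype.card_pos]
  have hb : 0 < b := by simp [b, Fintype.card_pos]
  set T : ℝ := Fintype.card (ι → α) * Fintype.card (ι → β)
  let P : (ι → α) → (ι → β) → (ι × ι) × (ι × ι) → Prop := fun f g q => q.1 ≠ q.2 ∧
    R (f q.1.1) (g q.1.2) = R (f q.2.1) (g q.2.2) ∧ R (f q.1.1) (g q.1.2) ≠ none
  have hP : ∀ q, ∑ f : ι → α, ∑ g : ι → β, (if P f g q then (1 : ℝ) else 0) ≤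
      T / b + if q.1.2 = q.2.2 then T / a else 0 := by
    rintro ⟨⟨i, j⟩, ⟨i', j'⟩⟩
    by_cases hj : j = j'
    · subst hj
      have hle : ∀ g : ι → β, ∑ f : ι → α, (if P f g ((i, j), (i', j)) then (1 : ℝ) else 0) ≤
          Fintype.card (ι → α) / a := by
        intro g
        rw [le_div_iff₀ ha, Finset.sum_boole]
        change _ * ((Fintype.card α : ℕ) : ℝ) ≤ _
        norm_cast
        refine card_mul_card_le_of_eq_of_eq_off i' _ fun f hf f' hf' h => ?_
        simp only [Finset.mem_filter, Finset.mem_univ, true_and, P, ne_eq, Prod.mk.injEq,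
          and_true] at hf hf'
        obtain ⟨hne, he, hn⟩ := hf
        obtain ⟨k, hk⟩ := Option.ne_none_iff_exists'.1 hn
        have hk' : R (f' i) (g j) = some k := by rw [← h i hne, hk]
        funext s
        by_cases hs : s = i'
        · subst hs
          exact hc _ _ _ k (he ▸ hk) (hf'.2.1 ▸ hk')
        · exact h s hs
      rw [Finset.sum_comm]
      calc _ ≤ ∑ _g : ι → β, Fintype.card (ι → α) / a := Finset.sum_le_sum fun g _ => hle g
        _ = T / a := by
          simp only [Finset.sum_const, Finset.card_univ, nsmul_eq_mul, T]
          ring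
        _ ≤ _ := by
          simp only [if_true]
          have : 0 ≤ T / b := by positivity
          linarith
    · have hle : ∀ f : ι → α, ∑ g : ι → β, (if P f g ((i, j), (i', j')) then (1 : ℝ) else 0) ≤
          Fintype.card (ι → β) / b := by
        intro f
        rw [le_div_iff₀ hb, Finset.sum_boole]
        change _ * ((Fintype.card β : ℕ) : ℝ) ≤ _
        norm_cast
        refine card_mul_card_le_of_eq_of_eq_off j' _ fun g hg g' hg' h => ?_
        simp only [Finset.mem_filter, Finset.mem_univ, true_and, P] at hg hg'
        obtain ⟨_, he, hn⟩ := hg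
        obtain ⟨k, hk⟩ := Option.ne_none_iff_exists'.1 hn
        have hk' : R (f i) (g' j) = some k := by rw [← h j hj, hk]
        funext s
        by_cases hs : s = j'
        · subst hs
          exact hr _ _ _ k (he ▸ hk) (hg'.2.1 ▸ hk')
        · exact h s hs
      calc _ ≤ ∑ _f : ι → α, Fintype.card (ι → β) / b := Finset.sum_le_sum fun f _ => hle f
        _ = T / b := by
          simp only [Finset.sum_const, Finset.card_univ, nsmul_eq_mul, T]
          ring
        _ ≤ _ := by simp [hj]
  have hdiag : ∑ q : (ι × ι) × (ι × ι), (if q.1.2 = q.2.2 then T / a else 0) =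
      (Fintype.card ι : ℝ) ^ 3 * (T / a) := by
    simp only [Fintype.sum_prod_type]
    simp
    ring
  calc _ = ∑ f : ι → α, ∑ g : ι → β, ∑ q, if P f g q then (1 : ℝ) else 0 := by simp [P]
    _ = ∑ q, ∑ f : ι → α, ∑ g : ι → β, if P f g q then (1 : ℝ) else 0 := 
        (Finset.sum_congr rfl fun f _ => Finset.sum_comm).trans Finset.sum_comm
    _ ≤ ∑ q : (ι × ι) × (ι × ι), (T / b + if q.1.2 = q.2.2 then T / a else 0) :=
        Finset.sum_le_sum fun q _ => hP q
    _ = _ := by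
        rw [Finset.sum_add_distrib, hdiag]
        simp
        ring

open Classical in
/-- If the selected colors in every small sample of a partial Latin array are at least as many as
expected, up to a small error, then so are the entries of the array with selected colors. -/
lemma card_selected_ge_of_samples [Nonempty ι] [Nonempty α] [Nonempty β] (R : α → β → Option κ)
    (hr : ∀ x y z k, R x y = some k → R x z = some k → y = z)
    (hc : ∀ x y z k, R y x = some k → R z x = some k → y = z)
    (S : Set κ) {p ε : ℝ} (hp : 0 ≤ p)
    (hS : ∀ (f : ι → α) (g : ι → β),
      p * (valueSet fun q : ι × ι => R (f q.1) (g q.2)).card - ε * (p * Fintype.card ι ^ 2) ≤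
        (((valueSet fun q : ι × ι => R (f q.1) (g q.2)).filter (· ∈ S)).card : ℝ)) :
    p * (Fintype.card α * Fintype.card β) * (1 - ε
        - (Finset.univ.filter fun z : α × β => R z.1 z.2 = none).card /
          (Fintype.card α * Fintype.card β)
        - ((Fintype.card ι : ℝ) ^ 2 / Fintype.card β + (Fintype.card ι : ℝ) / Fintype.card α)) ≤
      ((Finset.univ.filter fun z : α × β => ∃ k ∈ S, R z.1 z.2 = some k).card : ℝ) := by
  have hsel := sum_sum_card_filter_mul_card (ι := ι) fun x y => ∃ k ∈ S, R x y = some k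
  have hnone : (∑ f : ι → α, ∑ g : ι → β,
        ((Finset.univ.filter fun q : ι × ι => R (f q.1) (g q.2) = none).card : ℝ)) *
        (Fintype.card α * Fintype.card β) =
      Fintype.card (ι → α) * Fintype.card (ι → β) * (Fintype.card ι ^ 2 *
        (Finset.univ.filter fun z : α × β => R z.1 z.2 = none).card) := by
    convert sum_sum_card_filter_mul_card (ι := ι) fun x y => R x y = none
  have hcoll := sum_sum_card_collisions_le (ι := ι) R hr hc
  set a : ℝ := (Fintype.card α : ℝ)
  set b : ℝ := (Fintype.card β : ℝ)
  set l : ℝ := (Fintype.card ι : ℝ)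
  have ha : 0 < a := by simp [a, Fintype.card_pos]
  have hb : 0 < b := by simp [b, Fintype.card_pos]
  have hl : 0 < l := by simp [l, Fintype.card_pos]
  have hT : 0 < (Fintype.card (ι → α) : ℝ) * Fintype.card (ι → β) := by
    have := Fintype.card_pos (α := ι → α)
    have := Fintype.card_pos (α := ι → β)
    positivity
  set E : ℝ := ((Finset.univ.filter fun z : α × β => ∃ k ∈ S, R z.1 z.2 = some k).card : ℝ)
  set D : ℝ := ((Finset.univ.filter fun z : α × β => R z.1 z.2 = none).card : ℝ)
  set c : ℝ := l ^ 2 / b + l / a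
  -- Selected cells are at least as many as selected colors, and distinct colors are bounded below
  -- by removing empty cells and collisions.
  have hpt : ∀ (f : ι → α) (g : ι → β), p * (l ^ 2
      - ((Finset.univ.filter fun q : ι × ι => R (f q.1) (g q.2) = none).card : ℝ)
      - ((Finset.univ.filter fun q : (ι × ι) × (ι × ι) => q.1 ≠ q.2 ∧
        R (f q.1.1) (g q.1.2) = R (f q.2.1) (g q.2.2) ∧
          R (f q.1.1) (g q.1.2) ≠ none).card : ℝ)) - ε * (p * l ^ 2) ≤
      ((Finset.univ.filter fun q : ι × ι => ∃ k ∈ S, R (f q.1) (g q.2) = some k).card : ℝ) := by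
    intro f g
    have h1 := card_le_card_valueSet_add fun q : ι × ι => R (f q.1) (g q.2)
    have h2 := card_valueSet_filter_le (fun q : ι × ι => R (f q.1) (g q.2)) S
    have h3 := hS f g
    rw [Fintype.card_prod] at h1
    have h2' : ((_ : ℕ) : ℝ) ≤ ((_ : ℕ) : ℝ) := Nat.cast_le.2 h2
    refine le_trans ?_ (h3.trans h2')
    refine sub_le_sub_right (mul_le_mul_of_nonneg_left ?_ hp) _
    rw [sq, sub_sub, sub_le_iff_le_add, ← add_assoc]
    change (Fintype.card ι : ℝ) * (Fintype.card ι : ℝ) ≤ _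
    norm_cast
    convert h1
  have hsum := Finset.sum_le_sum fun (f : ι → α) (_ : f ∈ Finset.univ) =>
    Finset.sum_le_sum fun (g : ι → β) (_ : g ∈ Finset.univ) => hpt f g
  simp only [Finset.sum_sub_distrib, ← Finset.mul_sum, Finset.sum_const, Finset.card_univ,
    nsmul_eq_mul] at hsum
  rw [← eq_div_iff (by positivity)] at hsel hnone
  rw [hsel, hnone] at hsum
  set T : ℝ := (Fintype.card (ι → α) : ℝ) * Fintype.card (ι → β) with hTdef
  have h1 : T * l ^ 2 * (p * (1 - ε - D / (a * b) - c)) ≤ T * l ^ 2 * (E / (a * b)) := by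
    calc _ = p * (T * l ^ 2 - T * (l ^ 2 * D) / (a * b) - T * (l ^ 2 * c))
          - ε * (p * (T * l ^ 2)) := by ring
      _ ≤ T * (l ^ 2 * E) / (a * b) := by
          refine le_trans ?_ hsum
          have := mul_le_mul_of_nonneg_left hcoll hp
          rw [hTdef] at *
          nlinarith
      _ = _ := by ring
  have h2 := le_of_mul_le_mul_left h1 (by positivity)
  rw [le_div_iff₀ (by positivity)] at h2
  linarith

end RandomSampling

lemma card_valueSet_le {ι κ : Type*} [Fintype ι] (R : ι → Option κ) :
    (valueSet R).card ≤ Fintype.card ι := by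
  classical
  simpa using (card_valueSet_filter_le R Set.univ).trans (Finset.card_le_univ _)

/-! ### Degrees and edge counts of the random subgraph -/

namespace SimpleGraph.EdgeLabeling

variable {V κ : Type*} [Fintype V] {G : SimpleGraph V}

open Classical in
lemma IsProper.card_filter_valueSet_color? {c : G.EdgeLabeling κ} (hc : c.IsProper) (S : Set κ)
    (v : V) : ((valueSet (c.color? v)).filter (· ∈ S)).card = (c.keep S).degree v := by
  rw [card_valueSet_filter_eq (fun _ _ _ => hc.color?_right_inj), ← card_neighborFinset_eq_degree,
    neighborFinset_eq_filter]
  simp only [keep_adj_iff]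

lemma IsProper.card_valueSet_color? [DecidableRel G.Adj] {c : G.EdgeLabeling κ} (hc : c.IsProper)
    (v : V) : (valueSet (c.color? v)).card = G.degree v := by
  classical
  have h := hc.card_filter_valueSet_color? Set.univ v
  have hG : c.keep Set.univ = G := by
    ext x y
    simp [keep]
  simp only [Set.mem_univ, Finset.filter_true] at h
  rw [h, ← card_neighborFinset_eq_degree, ← card_neighborFinset_eq_degree]
  congr 1
  ext w
  simp only [mem_neighborFinset, hG]

open Classical in
/-- If every small sample of pairs of vertices sees about as many selected colors as expected, then
there are about as many edges of selected colors between two large sets as expected. -/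
lemma IsProper.card_interedges_keep_ge [DecidableRel G.Adj] {c : G.EdgeLabeling κ}
    (hc : c.IsProper) {d p ε : ℝ} (hd : ∀ v, Fintype.card V - d ≤ G.degree v) (hp : 0 ≤ p)
    (S : Set κ) {l : ℕ} (hl : 0 < l)
    (hS : ∀ f g : Fin l → V,
      p * (valueSet fun q : Fin l × Fin l => c.color? (f q.1) (g q.2)).card - ε * (p * l ^ 2) ≤
        (((valueSet fun q : Fin l × Fin l => c.color? (f q.1) (g q.2)).filter (· ∈ S)).card : ℝ))
    {A B : Finset V} (hA : A.Nonempty) (hB : B.Nonempty) :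
    p * (A.card * B.card) * (1 - ε - d / B.card - ((l : ℝ) ^ 2 / B.card + l / A.card)) ≤
      (((c.keep S).interedges A B).card : ℝ) := by
  have : Nonempty (Fin l) := ⟨⟨0, hl⟩⟩
  have : Nonempty A := hA.to_subtype
  have : Nonempty B := hB.to_subtype
  have hA0 : (0 : ℝ) < A.card := by exact_mod_cast hA.card_pos
  have hB0 : (0 : ℝ) < B.card := by exact_mod_cast hB.card_pos
  have h := card_selected_ge_of_samples (ι := Fin l) (α := A) (β := B)
    (fun x y => c.color? x y)
    (fun x y z k h1 h2 => Subtype.ext (hc.color?_right_inj h1 h2))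
    (fun x y z k h1 h2 => Subtype.ext (hc.color?_left_inj h1 h2)) S (ε := ε) hp
    (fun f g => by simpa using hS (fun i => f i) fun i => g i)
  simp only [Fintype.card_coe, Fintype.card_fin] at h
  have hE : (Finset.univ.filter fun z : A × B => ∃ k ∈ S, c.color? (z.1 : V) z.2 = some k).card ≤
      ((c.keep S).interedges A B).card := by
    refine Finset.card_le_card_of_injOn (fun z => ((z.1 : V), (z.2 : V))) ?_ ?_
    · intro z hz
      simp only [Finset.coe_filter, Finset.mem_univ, true_and, Set.mem_ofPred_eq] at hz
      exact (mk_mem_interedges_iff _).2 ⟨z.1.2, z.2.2, keep_adj_iff.2 hz⟩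
    · intro z _ w _ hzw
      exact Prod.ext (Subtype.ext (congrArg Prod.fst hzw)) (Subtype.ext (congrArg Prod.snd hzw))
  have hN : ((Finset.univ.filter fun z : A × B => c.color? (z.1 : V) z.2 = none).card : ℝ) ≤
      A.card * d := by
    -- The degree condition leaves at most `d` vertices not adjacent to `x`.
    have hrow : ∀ x : A, ((Finset.univ.filter fun y : B =>
        c.color? (x : V) y = none).card : ℝ) ≤ d := by
      intro x
      have h1 : (Finset.univ.filter fun y : B => c.color? (x : V) y = none).card ≤
          (Finset.univ.filter fun y : V => ¬ G.Adj x y).card := by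
        refine Finset.card_le_card_of_injOn Subtype.val ?_ Subtype.val_injective.injOn
        intro y hy
        simpa [color?_eq_none] using hy
      have h2 : (Finset.univ.filter fun y : V => G.Adj x y).card +
          (Finset.univ.filter fun y : V => ¬ G.Adj x y).card = Fintype.card V :=
        Finset.card_filter_add_card_filter_not _
      rw [← neighborFinset_eq_filter, card_neighborFinset_eq_degree] at h2
      have h3 := hd x
      rw [← h2] at h3
      push_cast at h3
      have h4 : ((_ : ℕ) : ℝ) ≤ ((_ : ℕ) : ℝ) := Nat.cast_le.2 h1
      linarith
    have hsum : ((Finset.univ.filter fun z : A × B => c.color? (z.1 : V) z.2 = none).card : ℝ) =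
        ∑ x : A, ((Finset.univ.filter fun y : B => c.color? (x : V) y = none).card : ℝ) := by
      rw [← Finset.sum_boole, Fintype.sum_prod_type]
      simp only [Finset.sum_boole]
    rw [hsum]
    refine (Finset.sum_le_sum fun x _ => hrow x).trans ?_
    simp
  refine le_trans (mul_le_mul_of_nonneg_left ?_ (by positivity))
    (h.trans (Nat.cast_le.2 hE))
  refine sub_le_sub_right (sub_le_sub_left ?_ _) _
  rw [div_le_div_iff₀ (by positivity) hB0]
  nlinarith

end SimpleGraph.EdgeLabeling

/-! ### Union bounds over vertices and over samples -/

section UnionBound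

open MeasureTheory ProbabilityTheory

lemma measureReal_exists_le {ι Ω : Type*} [Fintype ι] [MeasurableSpace Ω] {μ : Measure Ω}
    (P : ι → Ω → Prop) {b : ℝ}
    (h : ∀ i, μ.real {ω | P i ω} ≤ b) : μ.real {ω | ∃ i, P i ω} ≤ Fintype.card ι * b := by
  rw [Set.ofPred_exists]
  refine (measureReal_iUnion_fintype_le _).trans ((Finset.sum_le_sum fun i _ => h i).trans ?_)
  simp

lemma log_le_logb_two {n : ℕ} (hn : 1 ≤ n) : Real.log n ≤ Real.logb 2 n := by
  have h1 : 0 ≤ Real.log n := Real.log_nonneg (by exact_mod_cast hn)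
  have h2 : Real.log 2 ≤ 1 := by linarith [Real.log_two_lt_d9]
  exact le_div_self h1 (Real.log_pos (by norm_num)) h2

section Probability

variable {V κ Ω : Type*} [Fintype V] {G : SimpleGraph V} {c : G.EdgeLabeling κ}
  [MeasurableSpace Ω] {μ : Measure Ω} [IsProbabilityMeasure μ] {sel : κ → Set Ω} {p : ℝ}

lemma measureReal_exists_degree_le [DecidableRel G.Adj] (hc : c.IsProper)
    (hmeas : ∀ k, MeasurableSet (sel k)) (hind : iIndepSet sel μ) (hp : 0 ≤ p)
    (hsel : ∀ k, μ (sel k) = ENNReal.ofReal p) {ε C : ℝ} (hε : 0 ≤ ε) (hε2 : ε ≤ 2)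
    (hC : 8 ≤ ε ^ 2 * C) (hV : 1 ≤ Fintype.card V)
    (hdeg : ∀ v, C * Real.logb 2 (Fintype.card V) ≤ p * G.degree v) :
    μ.real {ω | ∃ v, ¬ ((1 - ε) * (p * G.degree v) ≤ ((c.keep {k | ω ∈ sel k}).degree v : ℝ) ∧
      ((c.keep {k | ω ∈ sel k}).degree v : ℝ) ≤ (1 + ε) * (p * G.degree v))} ≤
      2 / Fintype.card V := by
  classical
  set n := Fintype.card V
  have hn0 : (0 : ℝ) < n := by exact_mod_cast hV
  -- `8 ≤ ε ^ 2 * C` makes the exponent at least `2 * log n`; two tails at `n` vertices then cost `2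
  -- / n`.
  have hexp : ∀ v, Real.exp (-(ε ^ 2 / 4) * (p * G.degree v)) ≤ 1 / (n : ℝ) ^ 2 := by
    intro v
    have h1 : (1 : ℝ) / (n : ℝ) ^ 2 = Real.exp (-(2 * Real.log n)) := by
      rw [Real.exp_neg, mul_comm, Real.exp_mul, Real.exp_log hn0, one_div]
      norm_num
    rw [h1, Real.exp_le_exp]
    have h2 := log_le_logb_two hV
    have h3 := mul_le_mul_of_nonneg_left (hdeg v) (sq_nonneg ε)
    have h4 : 0 ≤ Real.log n := Real.log_nonneg (by exact_mod_cast hV)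
    nlinarith [mul_le_mul_of_nonneg_right hC (h4.trans h2)]
  have key : ∀ v, μ.real {ω | ¬ ((1 - ε) * (p * G.degree v) ≤
      ((c.keep {k | ω ∈ sel k}).degree v : ℝ) ∧
      ((c.keep {k | ω ∈ sel k}).degree v : ℝ) ≤ (1 + ε) * (p * G.degree v))} ≤
      2 * (1 / (n : ℝ) ^ 2) := by
    intro v
    have hlow := measureReal_card_selected_le hmeas hind hp hsel (valueSet (c.color? v)) le_rfl
      hε hε2
    have hhigh := measureReal_le_card_selected hmeas hind hp hsel (valueSet (c.color? v)) le_rfl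
      hε hε2
    have hcard : ∀ ω, ((valueSet (c.color? v)).filter fun k => ω ∈ sel k).card =
        (c.keep {k | ω ∈ sel k}).degree v :=
      fun ω => hc.card_filter_valueSet_color? {k | ω ∈ sel k} v
    simp only [hcard, hc.card_valueSet_color?] at hlow hhigh
    refine (measureReal_mono (h₂ := measure_ne_top _ _) (fun ω hω => ?_)).trans
      ((measureReal_union_le _ _).trans
        ((add_le_add (hlow.trans (hexp v)) (hhigh.trans (hexp v))).trans_eq (two_mul _).symm))
    simp only [Set.mem_ofPred_eq, not_and_or, not_le, Set.mem_union] at hω ⊢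
    rcases hω with h | h
    · left
      linarith
    · right
      linarith
  refine (measureReal_exists_le _ key).trans_eq ?_
  change (n : ℝ) * _ = _
  field_simp

open Classical in
lemma measureReal_exists_sample_le (c : G.EdgeLabeling κ)
    (hmeas : ∀ k, MeasurableSet (sel k)) (hind : iIndepSet sel μ) (hp : 0 ≤ p)
    (hsel : ∀ k, μ (sel k) = ENNReal.ofReal p) {ε C : ℝ} (hε : 0 ≤ ε) (hε2 : ε ≤ 2)
    (hC : 12 ≤ ε ^ 2 * C) (hV : 1 ≤ Fintype.card V) {l : ℕ} (hl : 0 < l)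
    (hpl : C * Real.logb 2 (Fintype.card V) ≤ p * l) :
    μ.real {ω | ∃ fg : (Fin l → V) × (Fin l → V),
      ¬ (p * (valueSet fun q : Fin l × Fin l => c.color? (fg.1 q.1) (fg.2 q.2)).card
          - ε * (p * l ^ 2) ≤
        (((valueSet fun q : Fin l × Fin l => c.color? (fg.1 q.1) (fg.2 q.2)).filter
          (· ∈ {k | ω ∈ sel k})).card : ℝ))} ≤ 1 / Fintype.card V := by
  set n := Fintype.card V with hn
  have hn0 : (0 : ℝ) < n := by exact_mod_cast hV
  have key : ∀ fg : (Fin l → V) × (Fin l → V), μ.real {ω |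
      ¬ (p * (valueSet fun q : Fin l × Fin l => c.color? (fg.1 q.1) (fg.2 q.2)).card
          - ε * (p * l ^ 2) ≤
        (((valueSet fun q : Fin l × Fin l => c.color? (fg.1 q.1) (fg.2 q.2)).filter
          (· ∈ {k | ω ∈ sel k})).card : ℝ))} ≤ Real.exp (-(ε ^ 2 / 4) * (p * l ^ 2)) := by
    intro fg
    refine (measureReal_mono (h₂ := measure_ne_top _ _) (fun ω hω => ?_)).trans
      (measureReal_card_selected_le hmeas hind hp hsel
        (valueSet fun q : Fin l × Fin l => c.color? (fg.1 q.1) (fg.2 q.2)) ?_ hε hε2)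
    · simp only [Set.mem_ofPred_eq, not_le] at hω ⊢
      exact hω.le
    · have := card_valueSet_le fun q : Fin l × Fin l => c.color? (fg.1 q.1) (fg.2 q.2)
      rw [Fintype.card_prod, Fintype.card_fin] at this
      rw [sq]
      exact_mod_cast this
  refine (measureReal_exists_le _ key).trans ?_
  have hcard : (Fintype.card ((Fin l → V) × (Fin l → V)) : ℝ) =
      Real.exp (2 * l * Real.log n) := by
    rw [mul_comm, Real.exp_mul, Real.exp_log hn0]
    simp only [Fintype.card_prod, Fintype.card_fun, Fintype.card_fin, ← hn]
    push_cast
    rw [← pow_add, ← two_mul, ← Real.rpow_natCast]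
    push_cast
    rfl
  -- There are `exp (2 * l * log n)` samples, and `12 ≤ ε ^ 2 * C` makes the Chernoff exponent at
  -- least `3 * l * log n`. The surplus `l * log n` yields `1 / n`.
  rw [hcard, ← Real.exp_add, one_div, ← Real.exp_log (inv_pos.2 hn0), Real.exp_le_exp,
    Real.log_inv]
  have h2 := log_le_logb_two hV
  have h4 : 0 ≤ Real.log n := Real.log_nonneg (by exact_mod_cast hV)
  have hl1 : (1 : ℝ) ≤ l := by exact_mod_cast hl
  have h5 : 12 * Real.log n ≤ ε ^ 2 * (p * l) := by
    have h3 := mul_le_mul_of_nonneg_left hpl (sq_nonneg ε)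
    nlinarith [mul_le_mul_of_nonneg_right hC (h4.trans h2)]
  nlinarith [mul_le_mul_of_nonneg_right h5 (zero_le_one.trans hl1),
    mul_le_mul_of_nonneg_right hl1 h4]

end Probability

end UnionBound

/-! ### Choice of constants and conclusion -/

lemma sampling_error_le {C D L a b d l ε : ℝ} (hC : 0 < C) (hD : 1 ≤ D) (hL : 1 ≤ L)
    (hCε : C * ε = 14 * D ^ 2) (hl : 0 ≤ l) (hlL : l ≤ 2 * (D * L)) (ha : C * L ≤ a)
    (hb : C * L ^ 2 ≤ b) (hd : C * d ≤ b) : d / b + (l ^ 2 / b + l / a) ≤ ε / 2 := by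
  have ha0 : 0 < a := lt_of_lt_of_le (by positivity) ha
  have hb0 : 0 < b := lt_of_lt_of_le (by positivity) hb
  have e1 : d / b ≤ 1 / C := by
    rw [div_le_div_iff₀ hb0 hC]
    linarith
  have e2 : l ^ 2 / b ≤ 4 * D ^ 2 / C := by
    rw [div_le_div_iff₀ hb0 hC]
    have h1 : l ^ 2 ≤ (2 * (D * L)) ^ 2 := by gcongr
    calc l ^ 2 * C ≤ (2 * (D * L)) ^ 2 * C := by gcongr
      _ = 4 * D ^ 2 * (C * L ^ 2) := by ring
      _ ≤ _ := by gcongr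
  have e3 : l / a ≤ 2 * D / C := by
    rw [div_le_div_iff₀ ha0 hC]
    calc l * C ≤ 2 * (D * L) * C := by gcongr
      _ = 2 * D * (C * L) := by ring
      _ ≤ _ := by gcongr
  -- As `1 ≤ D`, the sum is at most `7 * D ^ 2 / C`, which is `ε / 2`.
  have e4 : 1 / C + 4 * D ^ 2 / C + 2 * D / C ≤ ε / 2 := by
    rw [← add_div, ← add_div, div_le_iff₀ hC]
    nlinarith
  linarith

/-- Color `k` is selected on the event `sel k`; the random subgraph at the outcome `ω` is
`c.keep {k | ω ∈ sel k}`. "With high probability" means that for each `η > 0` the probability is at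
least `1 - η` once the number of vertices is at least some `N` that depends on `ε`, `C`, `η` only.
For disjoint `A`, `B` the number of edges between them is the cardinality of `interedges A B`. -/
theorem theorem1p6 :
    ∃ ε₀ : ℝ, 0 < ε₀ ∧ ∀ ε : ℝ, 0 < ε → ε < ε₀ → ∃ C : ℝ, 0 < C ∧
      ∀ η : ℝ, 0 < η → ∃ N : ℕ, ∀ n : ℕ, N ≤ n →
        ∀ (V : Type*) [Fintype V] (G : SimpleGraph V) [DecidableRel G.Adj]
          (κ : Type*) (c : G.EdgeLabeling κ) (δ p : ℝ)
          (Ω : Type*) [MeasurableSpace Ω] (μ : MeasureTheory.Measure Ω)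
          [MeasureTheory.IsProbabilityMeasure μ] (sel : κ → Set Ω),
          Fintype.card V = n →
          c.IsProper →
          (1 - δ) * n ≤ (G.minDegree : ℝ) →
          0 < p → p ≤ 1 →
          (∀ k, MeasurableSet (sel k)) →
          ProbabilityTheory.iIndepSet sel μ →
          (∀ k, μ (sel k) = ENNReal.ofReal p) →
          1 - η ≤ μ.real {ω |
            (C * (Real.logb 2 n / p) ≤ (1 - δ) * n →
              ∀ v : V,
                (1 - ε) * (p * G.degree v) ≤ ((c.keep {k | ω ∈ sel k}).degree v : ℝ) ∧
                ((c.keep {k | ω ∈ sel k}).degree v : ℝ) ≤ (1 + ε) * (p * G.degree v)) ∧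
            (∀ A B : Finset V, Disjoint A B →
              C * (Real.logb 2 n / p) ≤ (A.card : ℝ) →
              max (C * (Real.logb 2 n / p) ^ 2) (C * (δ * n)) ≤ (B.card : ℝ) →
              (1 - ε) * p * A.card * B.card ≤
                (((c.keep {k | ω ∈ sel k}).interedges A B).card : ℝ))} := by

  classical
  refine ⟨1, one_pos, fun ε hε hε1 => ?_⟩
  have hε2 : ε ^ 2 ≤ 1 := by nlinarith
  -- Samples are used with error `ε / 2`, and `48` gives `(ε / 2) ^ 2 * D = 12`.
  obtain ⟨D, hD⟩ : ∃ D : ℝ, D = 48 / ε ^ 2 := ⟨_, rfl⟩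
  have hD0 : 48 ≤ D := by
    rw [hD, le_div_iff₀ (by positivity)]
    linarith
  have hDε : ε ^ 2 * D = 48 := by
    rw [hD]
    field_simp
  obtain ⟨C, hC⟩ : ∃ C : ℝ, C = 14 * D ^ 2 / ε := ⟨_, rfl⟩
  have hCε : C * ε = 14 * D ^ 2 := by
    rw [hC]
    field_simp
  have hC0 : 0 < C := by
    rw [hC]
    positivity
  have hDC : D ≤ C := by nlinarith
  -- The `2` ensures `1 ≤ logb 2 n`; the `3` adds failure probabilities `2 / n` for degrees and `1 /
  -- n` for samples.
  refine ⟨C, hC0, fun η hη => ⟨max 2 ⌈3 / η⌉₊, ?_⟩⟩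
  intro n hn V _ G _ κ c δ p Ω _ μ _ sel hcard hc hδ hp hp1 hmeas hind hsel
  have hn2 : 2 ≤ n := (le_max_left _ _).trans hn
  have hn0 : (0 : ℝ) < n := by positivity
  have hnη : 3 / n ≤ η := by
    rw [div_le_comm₀ hn0 hη]
    exact Nat.ceil_le.1 ((le_max_right _ _).trans hn)
  have hlog : 1 ≤ Real.logb 2 n := by
    rw [Real.le_logb_iff_rpow_le (by norm_num) hn0, Real.rpow_one]
    exact_mod_cast hn2
  set L : ℝ := Real.logb 2 n / p with hL
  have hL1 : 1 ≤ L := by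
    rw [hL, le_div_iff₀ hp]
    linarith
  have hpL : p * L = Real.logb 2 n := mul_div_cancel₀ _ hp.ne'
  have hdeg : ∀ v, (1 - δ) * n ≤ G.degree v := fun v =>
    hδ.trans (by exact_mod_cast G.minDegree_le_degree v)
  set l : ℕ := ⌈D * L⌉₊ with hl
  have hlD : D * L ≤ l := Nat.le_ceil _
  have hDL : 1 ≤ D * L := by nlinarith
  have hl2 : (l : ℝ) ≤ 2 * (D * L) := by
    have := Nat.ceil_lt_add_one (zero_le_one.trans hDL)
    linarith
  have hl0 : 0 < l := by
    have : (0 : ℝ) < l := by linarith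
    exact_mod_cast this
  have hsample := measureReal_exists_sample_le (μ := μ) c hmeas hind hp.le hsel (ε := ε / 2)
    (C := D) (by linarith) (by linarith) (by nlinarith) (by omega) hl0 (by
      rw [hcard, ← hpL]
      nlinarith)
  have hdegree : μ.real {ω | ¬ (C * L ≤ (1 - δ) * n → ∀ v : V,
      (1 - ε) * (p * G.degree v) ≤ ((c.keep {k | ω ∈ sel k}).degree v : ℝ) ∧
      ((c.keep {k | ω ∈ sel k}).degree v : ℝ) ≤ (1 + ε) * (p * G.degree v))} ≤ 2 / n := by
    by_cases hbig : C * L ≤ (1 - δ) * n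
    · have h := measureReal_exists_degree_le (μ := μ) hc hmeas hind hp.le hsel (ε := ε) (C := C)
        hε.le (by linarith) (by nlinarith [sq_nonneg ε]) (by omega) (fun v => by
          rw [hcard, ← hpL]
          nlinarith [mul_le_mul_of_nonneg_left (hbig.trans (hdeg v)) hp.le])
      rw [hcard] at h
      simpa only [hbig, true_imp_iff, not_forall] using h
    · simp only [hbig, false_imp_iff, not_true_eq_false]
      simpa using div_nonneg zero_le_two hn0.le
  rw [hcard] at hsample
  have hbad := (MeasureTheory.measureReal_union_le (μ := μ) _ _).trans (add_le_add hdegree hsample)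
  have hbad' : _ ≤ η := hbad.trans (le_of_eq_of_le (by ring) hnη)
  refine (sub_le_sub_left hbad' 1).trans ?_
  rw [sub_le_iff_le_add]
  -- Covering the whole space by the good event and the two bad ones needs only subadditivity, not
  -- measurability of the events.
  have huniv : μ.real Set.univ = 1 := by simp
  refine huniv.ge.trans ?_
  refine (MeasureTheory.measureReal_mono (h₂ := MeasureTheory.measure_ne_top _ _) (fun ω _ => ?_)).trans
    (MeasureTheory.measureReal_union_le _ _)
  by_contra hω
  simp only [Set.mem_union, not_or, Set.mem_ofPred_eq, not_not, not_exists] at hω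
  obtain ⟨hgood, hdω, hsω⟩ := hω
  refine hgood ⟨hdω, fun A B _ hA hB => ?_⟩
  have hB1 := (le_max_left _ _).trans hB
  have hB2 := (le_max_right _ _).trans hB
  have hA0 : (0 : ℝ) < A.card := lt_of_lt_of_le (by positivity) hA
  have hB0 : (0 : ℝ) < B.card := lt_of_lt_of_le (by positivity) hB1
  have h := hc.card_interedges_keep_ge (d := δ * n) (ε := ε / 2) (fun v => by
      rw [hcard]
      linarith [hdeg v]) hp.le {k | ω ∈ sel k} hl0 (fun f g => hsω (f, g))
    (Finset.card_pos.1 (by exact_mod_cast hA0)) (Finset.card_pos.1 (by exact_mod_cast hB0))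
  refine le_trans ?_ h
  have e5 : (1 - ε) ≤ 1 - ε / 2 - δ * n / B.card - ((l : ℝ) ^ 2 / B.card + l / A.card) := by
    linarith [sampling_error_le hC0 (by linarith) hL1 hCε l.cast_nonneg hl2 hA hB1 hB2]
  calc (1 - ε) * p * A.card * B.card = p * (A.card * B.card) * (1 - ε) := by ring
    _ ≤ _ := mul_le_mul_of_nonneg_left e5 (by positivity)
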